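/- Let $K$ be a field. A layered graph $\Gamma$ is a directed graph with vertex set a disjoint union $V=\bigcup_{i=0}^nV_i$ and edge set $E$ such that each edge $e$ with tail in $V_i$ has its head in $V_{i-1}$. For a path $\pi=(e_1,\dots,e_l)$ (head of $e_i$ = tail of $e_{i+1}$), write $(\tau-e_1)\cdots(\tau-e_l)=\sum_{j=0}^{l}e(\pi,j)\tau^{l-j}$, with $\tau$ a central variable over the free associative $K$-algebra $T(E)$ on $E$. Let $A(\Gamma)=T(E)/R$, where $R$ is the two-sided ideal generated by all $e(\pi_1,k)-e(\pi_2,k)$, for paths $\pi_1,\pi_2$ with the same tail and the same head and $1\le k\le l(\pi_1)$. It is graded by word length, with Hilbert series $H(A(\Gamma),t)=\sum_i\dim_K A(\Gamma)_i\,t^i$. Let $n\ge 0$, $m_0=1$, and let $\Gamma=\mathbf C[m_n,\dots,m_1,1]$ be the complete layered graph: $|V_i|=m_i$ for $0\le i\le n$, and for all $1\le i\le n$, $v\in V_i$, $w\in V_{i-1}$ there is a unique edge from $v$ to $w$. Assume that every vertex outside $V_0$ is the tail of some edge (equivalently, $m_{i}>0$ whenever $m_{i+1}>0$, $0\le i<n$).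 Then $$\frac{1-t}{H(A(\Gamma),t)}=1-\sum_{k=0}^n\sum_{a=k}^n(-1)^k\,m_a(m_{a-1}-1)(m_{a-2}-1)\cdots(m_{a-k+1}-1)\,m_{a-k}\,t^{k+1},$$ where for $k=0$ the product is the single factor $m_a$, and for $k=1$ it is $m_am_{a-1}$. If moreover $m_0=m_1=\dots=m_n=1$, then $A(\Gamma)$ is isomorphic, as a graded algebra, to the free associative algebra on $n$ generators (each of degree $1$), and the Hilbert series of both is $\dfrac{1}{1-nt}$. -/

import Mathlib

universe u v w

/-- A layered directed graph: vertices carry a level in `ℕ`, and every edge goes from its tail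
down by exactly one level to its head. -/
structure LayeredGraph where
  /-- the vertices -/
  V : Type u
  /-- the edges -/
  E : Type v
  /-- the tail of an edge -/
  tail : E → V
  /-- the head of an edge -/
  head : E → V
  /-- the level `|v|` of a vertex -/
  level : V → ℕ
  level_tail : ∀ e, level (tail e) = level (head e) + 1

namespace LayeredGraph

/-- The list of edges `p = [e₁, …, eₘ]` is a path from `a` to `b`: consecutive edges match,
`e₁` starts at `a` and `eₘ` ends at `b`. -/
def IsPath (Γ : LayeredGraph.{u, v}) : Γ.V → Γ.V → List Γ.E → Prop
  | a, b, [] => a = b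
  | a, b, e :: p => Γ.tail e = a ∧ IsPath Γ (Γ.head e) b p

/-- The polynomial `P_π(τ) = (τ - e₁)(τ - e₂)⋯(τ - eₘ)` over the free associative algebra on the
edges, where `τ` is a central variable. -/
noncomputable def pathPoly (Γ : LayeredGraph.{u, v}) (K : Type w) [Field K] (p : List Γ.E) :
    Polynomial (FreeAlgebra K Γ.E) :=
  (p.map fun e => Polynomial.X - Polynomial.C (FreeAlgebra.ι K e)).prod

/-- The coefficient `e(π, j)` of `τ ^ (m - j)` in `P_π(τ)`, where `m` is the length of `π`
(used for `j ≤ m` only). -/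
noncomputable def pathCoeff (Γ : LayeredGraph.{u, v}) (K : Type w) [Field K] (p : List Γ.E)
    (j : ℕ) : FreeAlgebra K Γ.E :=
  (Γ.pathPoly K p).coeff (p.length - j)

/-- The defining relations `e(π₁, k) = e(π₂, k)`, `1 ≤ k ≤ l(π₁)`, for paths `π₁`, `π₂` with the
same tail and the same head. -/
def Rel (Γ : LayeredGraph.{u, v}) (K : Type w) [Field K] (x y : FreeAlgebra K Γ.E) : Prop :=
  ∃ (a b : Γ.V) (p q : List Γ.E) (k : ℕ), Γ.IsPath a b p ∧ Γ.IsPath a b q ∧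
    1 ≤ k ∧ k ≤ p.length ∧ x = Γ.pathCoeff K p k ∧ y = Γ.pathCoeff K q k

/-- The algebra `A(Γ) = T(E) / R`, where `R` is the two-sided ideal generated by the elements
`e(π₁, k) - e(π₂, k)`. -/
abbrev Alg (Γ : LayeredGraph.{u, v}) (K : Type w) [Field K] : Type (max v w) :=
  RingQuot (Γ.Rel K)

end LayeredGraph

/-- The degree `i` component of the free associative algebra on `E`: the span of the words of
length `i`. -/
def freeDegree (K : Type w) [Field K] (E : Type v) (i : ℕ) : Submodule K (FreeAlgebra K E) :=
  Submodule.span K {x | ∃ l : List E, l.length = i ∧ x = (l.map (FreeAlgebra.ι K)).prod}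

/-- The Hilbert series `∑ (dim Aᵢ) tⁱ` of a family of subspaces `Aᵢ` of an algebra. -/
noncomputable def hilbertSeries {K : Type w} [Field K] {A : Type u} [Ring A] [Algebra K A]
    (𝒜 : ℕ → Submodule K A) : PowerSeries ℚ :=
  PowerSeries.mk fun i => (Module.finrank K (𝒜 i) : ℚ)

namespace LayeredGraph

/-- The degree `i` component of `A(Γ)`: the image of the degree `i` component of `T(E)`
(the relations are homogeneous). -/
noncomputable def degree (Γ : LayeredGraph.{u, v}) (K : Type w) [Field K] (i : ℕ) :
    Submodule K (Γ.Alg K) :=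
  (freeDegree K Γ.E i).map (RingQuot.mkAlgHom K (Γ.Rel K)).toLinearMap

/-- `Γ` is the complete layered graph `C[mₙ, …, m₁, m₀]`: the levels are `0, …, n`, there are
exactly `mᵢ` vertices of level `i`, and for any two vertices in adjacent levels there is a unique
edge from the upper one to the lower one. -/
structure IsComplete (Γ : LayeredGraph.{u, v}) (n : ℕ) (m : ℕ → ℕ) : Prop where
  level_le : ∀ a, Γ.level a ≤ n
  card_level : ∀ i ≤ n, {a | Γ.level a = i}.encard = (m i : ℕ∞)
  existsUnique_edge : ∀ a b, Γ.level a = Γ.level b + 1 → ∃! e, Γ.tail e = a ∧ Γ.head e = b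

end LayeredGraph

/-- The product `m_a (m_{a-1} - 1) ⋯ (m_{a-k+1} - 1) m_{a-k}` for `k ≤ a`. For `k = 0` it is the
single factor `m_a`. -/
def layerProd (m : ℕ → ℕ) (k a : ℕ) : ℚ :=
  if k = 0 then m a else m a * (∏ j ∈ Finset.Ico 1 k, ((m (a - j) : ℚ) - 1)) * m (a - k)

/-! Choose a base vertex in each nonempty level and let `f v` be the sum of the edges along the path
from `v` to the bottom through base vertices. The linear relations for paths of length two make
every edge equal to `f (tail) - f (head)`. Any two paths with the same ends are joined by moves
across diamonds, so A(Γ) is governed by elements `f v`, zero on level 0, whose products `(f v - f w)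
* (f w - f x)` do not depend on the middle vertex `w` (`DiamondFamily`).

Write b_i for the base element of level i and d_w = f w - b_|w| for an extra (non-base) vertex w.
With i = |w|, the diamond relations become the rewriting rules d_v d_w = 0 for |v| = i + 1 and
b_{i+1} d_w = b_i d_w + d_w b_i + d_w d_w - d_w b_{i-1}. A normal word never has a letter followed
by an extra letter one level lower. Its letters stand for b_i and d_w.

Normal words form a basis: the rules define operators on the space of words that satisfy the diamond
relations (`diamondFamily_vertexOp`), hence an action of A(Γ). Acting on the empty word gives a
normal form, and evaluating words in A(Γ) inverts it (`evalWords_wordRep`, `map_normalForm_degree`).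

Normal words are counted by their first letter. The words allowed after a vertex are all normal
words minus those starting with a blocked letter, which gives a recursion down the levels
(`wordSeries_followers`). Multiplying by 1 - t turns the result into the stated sum
(`one_sub_sum_layerProd`). If every level is a singleton, parallel paths coincide and the relations
are vacuous. -/

/-- A set of vertices graded by levels, with a single vertex of level `0` and a distinguished
vertex in every nonempty level; the nonempty levels form an initial segment. -/
structure PointedLevels (V : Type u) where
  /-- the level of a vertex -/
  level : V → ℕ
  /-- the distinguished vertex of a level -/
  base : ℕ → V
  level_base : ∀ v i, i ≤ level v → level (base i) = i
  eq_base : ∀ v, level v = 0 → v = base 0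

namespace PointedLevels

open Finsupp

variable {V : Type u} (P : PointedLevels V)

/-- The vertex is not the distinguished one of its level. -/
def IsExtra (v : V) : Prop := v ≠ P.base (P.level v)

/-- The two-letter word `v w` is not normal. -/
def Blocks (v w : V) : Prop := P.level v = P.level w + 1 ∧ P.IsExtra w

/-- The word `v ω` is not normal already because of its first two letters. -/
def BlocksWord (v : V) (ω : List V) : Prop := ∃ w ∈ ω.head?, P.Blocks v w

variable {P}

theorem IsExtra.level_pos {v : V} (h : P.IsExtra v) : 0 < P.level v := by
  rcases Nat.eq_zero_or_pos (P.level v) with h0 | h0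
  · exact absurd (by rw [h0]; exact P.eq_base v h0) h
  · exact h0

variable (P)

theorem not_isExtra_base {v : V} {i : ℕ} (h : i ≤ P.level v) : ¬ P.IsExtra (P.base i) := by
  simp [IsExtra, P.level_base v i h]

@[simp] theorem not_blocksWord_nil (v : V) : ¬ P.BlocksWord v [] := by simp [BlocksWord]

@[simp] theorem blocksWord_cons (v w : V) (ω : List V) :
    P.BlocksWord v (w :: ω) ↔ P.Blocks v w := by simp [BlocksWord]

theorem not_blocks_base {v w : V} {i : ℕ} (h : i ≤ P.level v) : ¬ P.Blocks w (P.base i) :=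
  fun hb => P.not_isExtra_base h hb.2

theorem not_blocks_of_level_eq {v w : V} (h : P.level v = P.level w) : ¬ P.Blocks v w :=
  fun hb => by have := hb.1; omega

/-! ### Rewriting rules as operators on the space of words -/

section Operators

variable (K : Type w) [Field K]

open Classical in
/-- Left multiplication by the difference of an extra vertex and the distinguished vertex of its
level, on the space with basis the normal words. -/
noncomputable def extraOp (v : V) : Module.End K (List V →₀ K) :=
  linearCombination K fun ω => if P.BlocksWord v ω then 0 else single (v :: ω) 1

open Classical in
/-- The product of the distinguished vertex of level `i` and a normal word, in normal form. -/
noncomputable def baseWord : List V → ℕ → (List V →₀ K)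
  | [], i => if i = 0 then 0 else single [P.base i] 1
  | w :: ω, i =>
    if i = 0 then 0 else
    if P.level w + 1 = i ∧ P.IsExtra w then
      single (P.base (P.level w) :: w :: ω) 1 + single (w :: P.base (P.level w) :: ω) 1
        + single (w :: w :: ω) 1 - P.extraOp K w (baseWord ω (P.level w - 1))
    else single (P.base i :: w :: ω) 1

/-- Left multiplication by the distinguished vertex of level `i` on the space with basis the
normal words. -/
noncomputable def baseOp (i : ℕ) : Module.End K (List V →₀ K) :=
  linearCombination K fun ω => P.baseWord K ω i

open Classical in
/-- Left multiplication by a vertex on the space with basis the normal words. -/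
noncomputable def vertexOp (v : V) : Module.End K (List V →₀ K) :=
  P.baseOp K (P.level v) + if P.IsExtra v then P.extraOp K v else 0

theorem extraOp_of_blocks {v : V} {ω : List V} (h : P.BlocksWord v ω) :
    P.extraOp K v (single ω 1) = 0 := by
  simp [extraOp, h]

theorem extraOp_of_not_blocks {v : V} {ω : List V} (h : ¬ P.BlocksWord v ω) :
    P.extraOp K v (single ω 1) = single (v :: ω) 1 := by
  simp [extraOp, h]

theorem baseOp_single (i : ℕ) (ω : List V) :
    P.baseOp K i (single ω 1) = P.baseWord K ω i := by
  simp [baseOp]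

@[simp] theorem baseWord_zero (ω : List V) : P.baseWord K ω 0 = 0 := by
  cases ω <;> simp [baseWord]

@[simp] theorem baseOp_zero : P.baseOp K 0 = 0 := by
  ext ω : 2
  simp [baseOp]

theorem baseWord_of_not_blocks {v : V} {ω : List V} (hv : 0 < P.level v)
    (h : ¬ P.BlocksWord v ω) :
    P.baseWord K ω (P.level v) = single (P.base (P.level v) :: ω) 1 := by
  cases ω with
  | nil => simp [baseWord, hv.ne']
  | cons w ω =>
    have : ¬ (P.level w + 1 = P.level v ∧ P.IsExtra w) := fun h' => h (by
      simpa [Blocks] using ⟨h'.1.symm, h'.2⟩)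
    simp only [baseWord, hv.ne', if_false, this]

theorem baseWord_of_blocks {v w : V} (ω : List V) (h : P.Blocks v w) :
    P.baseWord K (w :: ω) (P.level v) =
      single (P.base (P.level w) :: w :: ω) 1 + single (w :: P.base (P.level w) :: ω) 1
        + single (w :: w :: ω) 1 - P.extraOp K w (P.baseWord K ω (P.level w - 1)) := by
  rw [baseWord, if_neg (by have := h.1; omega), if_pos ⟨h.1.symm, h.2⟩]

theorem extraOp_extraOp {v w : V} (h : P.Blocks v w) (x : List V →₀ K) :
    P.extraOp K v (P.extraOp K w x) = 0 := by
  have : P.extraOp K v ∘ₗ P.extraOp K w = 0 := by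
    ext ω : 2
    by_cases hω : P.BlocksWord w ω
    · simp [P.extraOp_of_blocks K hω]
    · simp only [LinearMap.comp_apply, lsingle_apply, P.extraOp_of_not_blocks K hω]
      rw [P.extraOp_of_blocks K (by simpa using h)]
      simp
  exact LinearMap.congr_fun this x

/-- The rule for b_{i+1} d_w, on every word. If w may precede ω, it is the definition of `baseWord`.
Otherwise this is the overlap of the two rules, where the left side is zero and the right side must
cancel. -/
theorem baseOp_extraOp {v w : V} (h : P.Blocks v w) (x : List V →₀ K) :
    P.baseOp K (P.level v) (P.extraOp K w x) =
      P.baseOp K (P.level w) (P.extraOp K w x) + P.extraOp K w (P.baseOp K (P.level w) x)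
        + P.extraOp K w (P.extraOp K w x)
        - P.extraOp K w (P.baseOp K (P.level w - 1) x) := by
  have hw := h.2.level_pos
  have hww : ¬ P.Blocks w w := P.not_blocks_of_level_eq rfl
  suffices H : P.baseOp K (P.level v) ∘ₗ P.extraOp K w =
      P.baseOp K (P.level w) ∘ₗ P.extraOp K w + P.extraOp K w ∘ₗ P.baseOp K (P.level w)
        + P.extraOp K w ∘ₗ P.extraOp K w
        - P.extraOp K w ∘ₗ P.baseOp K (P.level w - 1) from LinearMap.congr_fun H x
  ext ω : 2
  simp only [LinearMap.comp_apply, lsingle_apply, LinearMap.add_apply, LinearMap.sub_apply,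
    baseOp_single]
  by_cases hω : P.BlocksWord w ω
  · obtain _ | ⟨y, ω⟩ := ω
    · simp at hω
    have hy : P.Blocks w y := by simpa using hω
    have hyy : ¬ P.Blocks y y := P.not_blocks_of_level_eq rfl
    have hlev : P.level w - 1 = P.level y := by have := hy.1; omega
    rw [P.extraOp_of_blocks K hω, P.baseWord_of_blocks K ω hy, hlev,
      P.baseWord_of_not_blocks K hy.2.level_pos (by simpa using hyy)]
    -- After rewriting b_|w| y, every term that starts with y is killed by d_w. The remaining term
    -- d_w b_|y| y cancels the last one, since |y| = |w| - 1.
    simp only [map_add, map_sub, P.extraOp_extraOp K hy, map_zero]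
    rw [P.extraOp_of_blocks K (ω := y :: P.base _ :: _) (by simpa using hy),
      P.extraOp_of_blocks K (ω := y :: y :: _) (by simpa using hy)]
    abel
  · rw [P.extraOp_of_not_blocks K hω, baseOp_single, baseOp_single, P.baseWord_of_blocks K ω h,
      P.baseWord_of_not_blocks K hw (by simpa using hww),
      P.baseWord_of_not_blocks K hw hω,
      P.extraOp_of_not_blocks K (by simpa using P.not_blocks_base le_rfl),
      P.extraOp_of_not_blocks K (by simpa using hww)]

end Operators

/-- A family of ring elements indexed by the vertices, zero in level `0`, for which the products
along the two sides of a diamond agree. -/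
structure DiamondFamily {R : Type*} [Ring R] (f : V → R) : Prop where
  zero : ∀ v, P.level v = 0 → f v = 0
  diamond : ∀ v w w' x, P.level v = P.level w + 1 → P.level w' = P.level w →
    P.level w = P.level x + 1 → (f v - f w) * (f w - f x) = (f v - f w') * (f w' - f x)

-- Expand the diamond with middle vertices w and the base vertex of the same level. The right side
-- involves no v, which is what makes the next lemma work.
variable {P} in
theorem DiamondFamily.mul_extra {R : Type*} [Ring R] {f : V → R} (hf : P.DiamondFamily f)
    {v w : V} (h : P.level v = P.level w + 1) :
    f v * (f w - f (P.base (P.level w))) =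
      f w * f w - f (P.base (P.level w)) * f (P.base (P.level w))
        - (f w - f (P.base (P.level w))) * f (P.base (P.level w - 1)) := by
  rcases Nat.eq_zero_or_pos (P.level w) with h0 | h0
  · rw [h0, ← P.eq_base w h0, hf.zero w h0]; simp
  · have := hf.diamond v w (P.base (P.level w)) (P.base (P.level w - 1)) h
      (P.level_base w _ le_rfl) (by rw [P.level_base w _ (by omega)]; omega)
    rw [← sub_eq_zero] at this ⊢
    rw [← this]
    noncomm_ring

-- By `mul_extra`, v and the base vertex of its level have the same product with d_w.
variable {P} in
theorem DiamondFamily.extra_mul_extra {R : Type*} [Ring R] {f : V → R}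
    (hf : P.DiamondFamily f) {v w : V} (h : P.level v = P.level w + 1) :
    (f v - f (P.base (P.level v))) * (f w - f (P.base (P.level w))) = 0 := by
  rw [sub_mul, hf.mul_extra h, hf.mul_extra (by rw [P.level_base v _ le_rfl, h]), sub_self]

theorem sub_mul_sub_of_mul_eq {R : Type*} [Ring R] {a b c d e : R}
    (had : a * d = b * d + d * b + d * d - d * e) (hdc : d * c = d * e) :
    (a - (b + d)) * (b + d - c) = (a - b) * (b - c) := by
  calc (a - (b + d)) * (b + d - c) =
      (a - b) * (b - c) + (a * d - (b * d + d * b + d * d - d * c)) := by noncomm_ring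
    _ = _ := by rw [had, hdc, sub_self, add_zero]

-- It suffices to replace the middle vertex w by the base of its level. Writing w as b + d, the
-- difference of the two products vanishes by the rule for `v * d`, together with d_w d_x = 0.
open Classical in
theorem diamondFamily_vertexOp (K : Type w) [Field K] : P.DiamondFamily (P.vertexOp K) := by
  have key : ∀ v w x, P.level v = P.level w + 1 → P.level w = P.level x + 1 →
      (P.vertexOp K v - P.vertexOp K w) * (P.vertexOp K w - P.vertexOp K x) =
      (P.vertexOp K v - P.baseOp K (P.level w)) * (P.baseOp K (P.level w) - P.vertexOp K x) := by
    intro v w x hvw hwx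
    by_cases hw : P.IsExtra w
    · have hvd : P.vertexOp K v * P.extraOp K w =
          P.baseOp K (P.level w) * P.extraOp K w + P.extraOp K w * P.baseOp K (P.level w)
          + P.extraOp K w * P.extraOp K w - P.extraOp K w * P.baseOp K (P.level x) := by
        refine LinearMap.ext fun y => ?_
        have h0 : (if P.IsExtra v then P.extraOp K v else 0) (P.extraOp K w y) = 0 := by
          split_ifs
          · exact P.extraOp_extraOp K ⟨hvw, hw⟩ y
          · rfl
        have := P.baseOp_extraOp K ⟨hvw, hw⟩ y
        rw [show P.level w - 1 = P.level x by omega] at this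
        simp only [vertexOp, Module.End.mul_apply, LinearMap.add_apply, LinearMap.sub_apply, h0,
          this, add_zero]
      have hdx : P.extraOp K w * P.vertexOp K x = P.extraOp K w * P.baseOp K (P.level x) := by
        refine LinearMap.ext fun y => ?_
        have h0 : P.extraOp K w ((if P.IsExtra x then P.extraOp K x else 0) y) = 0 := by
          split_ifs with hx
          · exact P.extraOp_extraOp K ⟨hwx, hx⟩ y
          · simp
        simp only [vertexOp, Module.End.mul_apply, LinearMap.add_apply, map_add, h0, add_zero]
      have hu : P.vertexOp K w = P.baseOp K (P.level w) + P.extraOp K w := by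
        simp [vertexOp, hw]
      rw [hu]
      exact sub_mul_sub_of_mul_eq (R := Module.End K (List V →₀ K)) hvd hdx
    · simp [vertexOp, hw]
  refine ⟨fun v hv => ?_, fun v w w' x hvw hw hwx => ?_⟩
  · have : ¬ P.IsExtra v := fun h => by have := h.level_pos; omega
    simp [vertexOp, this, hv]
  · rw [key v w x hvw hwx, key v w' x (by omega) (by omega), hw]

end PointedLevels

/-! ### Evaluation of words in a ring with a diamond family -/

namespace PointedLevels

open Finsupp

variable {V : Type u} (P : PointedLevels V)

section Evaluation

variable (K : Type w) [Field K] {R : Type*} [Ring R] [Algebra K R]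

open Classical in
/-- The letter `v` of a normal word as a ring element: the distinguished vertices stand for
themselves, the others for their difference with the distinguished vertex of their level. -/
noncomputable def letter (f : V → R) (v : V) : R :=
  if P.IsExtra v then f v - f (P.base (P.level v)) else f v

/-- Words as products of ring elements, extended linearly. -/
noncomputable def evalWords (f : V → R) : (List V →₀ K) →ₗ[K] R :=
  linearCombination K fun ω => (ω.map (P.letter f)).prod

theorem evalWords_single (f : V → R) (ω : List V) :
    P.evalWords K f (single ω 1) = (ω.map (P.letter f)).prod := by
  simp [evalWords]

theorem letter_of_isExtra (f : V → R) {v : V} (h : P.IsExtra v) :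
    P.letter f v = f v - f (P.base (P.level v)) := by simp [letter, h]

theorem letter_base (f : V → R) {v : V} {i : ℕ} (h : i ≤ P.level v) :
    P.letter f (P.base i) = f (P.base i) := by simp [letter, P.not_isExtra_base h]

variable {P} {f : V → R}

theorem DiamondFamily.evalWords_extraOp (hf : P.DiamondFamily f) {v : V} (hv : P.IsExtra v)
    (x : List V →₀ K) :
    P.evalWords K f (P.extraOp K v x) =
      (f v - f (P.base (P.level v))) * P.evalWords K f x := by
  suffices H : P.evalWords K f ∘ₗ P.extraOp K v =
      LinearMap.mulLeft K (f v - f (P.base (P.level v))) ∘ₗ P.evalWords K f from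
    LinearMap.congr_fun H x
  ext ω : 2
  simp only [LinearMap.comp_apply, lsingle_apply, LinearMap.mulLeft_apply]
  by_cases hω : P.BlocksWord v ω
  · obtain _ | ⟨y, ω⟩ := ω
    · simp at hω
    have hy : P.Blocks v y := by simpa using hω
    rw [P.extraOp_of_blocks K hω, map_zero, P.evalWords_single, List.map_cons, List.prod_cons,
      P.letter_of_isExtra f hy.2, ← mul_assoc, hf.extra_mul_extra hy.1, zero_mul]
  · rw [P.extraOp_of_not_blocks K hω, P.evalWords_single, P.evalWords_single, List.map_cons,
      List.prod_cons, P.letter_of_isExtra f hv]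

theorem DiamondFamily.evalWords_baseWord (hf : P.DiamondFamily f) (ω : List V) {v : V} {i : ℕ}
    (hi : i ≤ P.level v) :
    P.evalWords K f (P.baseWord K ω i) = f (P.base i) * P.evalWords K f (single ω 1) := by
  have hlev := P.level_base v i hi
  rcases Nat.eq_zero_or_pos i with rfl | h0
  · simp [hf.zero _ hlev]
  induction ω generalizing i with
  | nil => simp [baseWord, h0.ne', evalWords_single, P.letter_base f hi]
  | cons w ω ih =>
    by_cases h : P.Blocks (P.base i) w
    · have hw := h.2.level_pos
      have hwi : P.level w + 1 = i := by rw [← h.1, hlev]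
      have hlow : P.evalWords K f (P.baseWord K ω (P.level w - 1)) =
          f (P.base (P.level w - 1)) * P.evalWords K f (single ω 1) := by
        -- The lower base vertex may lie on level 0, where it stands for zero; the induction covers
        -- positive levels only.
        rcases Nat.eq_zero_or_pos (P.level w - 1) with h1 | h1
        · rw [h1, baseWord_zero, map_zero, hf.zero _ (P.level_base w 0 (by omega)), zero_mul]
        · exact ih (by omega) (P.level_base w _ (by omega)) h1
      have hmul := hf.mul_extra h.1
      have := P.baseWord_of_blocks K ω h
      rw [hlev] at this
      rw [this, map_sub, map_add, map_add, hf.evalWords_extraOp K h.2, hlow]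
      simp only [evalWords_single, List.map_cons, List.prod_cons, P.letter_of_isExtra f h.2,
        P.letter_base f (le_refl (P.level w)), ← mul_assoc, hmul]
      noncomm_ring
    · have := P.baseWord_of_not_blocks K (v := P.base i) (ω := w :: ω) (by omega) (by simpa using h)
      rw [hlev] at this
      rw [this, evalWords_single, evalWords_single, List.map_cons, List.prod_cons,
        P.letter_base f hi]

/-- The rules hold in every ring with a diamond family, so evaluation turns the operators into left
multiplications. -/
theorem DiamondFamily.evalWords_vertexOp (hf : P.DiamondFamily f) (v : V) (x : List V →₀ K) :
    P.evalWords K f (P.vertexOp K v x) = f v * P.evalWords K f x := by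
  have hb : P.evalWords K f (P.baseOp K (P.level v) x) =
      f (P.base (P.level v)) * P.evalWords K f x := by
    suffices H : P.evalWords K f ∘ₗ P.baseOp K (P.level v) =
        LinearMap.mulLeft K (f (P.base (P.level v))) ∘ₗ P.evalWords K f from
      LinearMap.congr_fun H x
    ext ω : 2
    simp only [LinearMap.comp_apply, lsingle_apply, LinearMap.mulLeft_apply, P.baseOp_single]
    exact hf.evalWords_baseWord K ω (v := v) le_rfl
  by_cases hv : P.IsExtra v
  · simp only [vertexOp, hv, if_true, LinearMap.add_apply, map_add, hb,
      hf.evalWords_extraOp K hv]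
    noncomm_ring
  · have : f v = f (P.base (P.level v)) := congrArg f (not_not.1 hv)
    simp [vertexOp, hv, hb, this]

end Evaluation

end PointedLevels

/-! ### Path relations versus diamond relations -/

namespace LayeredGraph

open Polynomial

variable {Γ : LayeredGraph.{u, v}}

theorem IsPath.level_eq {a b : Γ.V} {p : List Γ.E} (h : Γ.IsPath a b p) :
    Γ.level a = Γ.level b + p.length := by
  induction p generalizing a with
  | nil => rw [show a = b from h]; rfl
  | cons e p ih =>
    rw [← h.1, Γ.level_tail, ih h.2, List.length_cons, add_assoc]

/-- One diamond move makes the first edge of `p` agree with that of `q`; the tails are then shorter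
paths with common ends. -/
theorem prod_map_eq_of_isPath {R : Type*} [Ring R] {f : Γ.V → R}
    (hedge : ∀ a b, Γ.level a = Γ.level b + 1 → ∃ e, Γ.tail e = a ∧ Γ.head e = b)
    (hf : ∀ a b b' c, Γ.level a = Γ.level b + 1 → Γ.level b' = Γ.level b →
      Γ.level b = Γ.level c + 1 → (f a - f b) * (f b - f c) = (f a - f b') * (f b' - f c))
    {a b : Γ.V} {p q : List Γ.E} (hp : Γ.IsPath a b p) (hq : Γ.IsPath a b q) :
    (p.map fun e => (X - C (f (Γ.tail e) - f (Γ.head e)) : R[X])).prod =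
      (q.map fun e => (X - C (f (Γ.tail e) - f (Γ.head e)) : R[X])).prod := by
  have hlen : p.length = q.length := by have := hp.level_eq; have := hq.level_eq; omega
  induction hn : p.length generalizing a p q with
  | zero =>
    rw [List.eq_nil_of_length_eq_zero hn, List.eq_nil_of_length_eq_zero (hlen.symm.trans hn)]
  | succ n ih =>
    obtain _ | ⟨e, p⟩ := p
    · simp at hn
    obtain _ | ⟨e', q⟩ := q
    · simp at hlen
    obtain ⟨rfl, hp⟩ := hp
    obtain ⟨ht, hq⟩ := hq
    simp only [List.length_cons, add_left_inj] at hlen hn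
    have hl := Γ.level_tail e
    have hl' := Γ.level_tail e'
    rw [ht] at hl'
    obtain _ | ⟨e₂, p⟩ := p
    · rw [List.eq_nil_of_length_eq_zero hlen.symm] at hq ⊢
      have : Γ.head e = Γ.head e' := Eq.trans (b := b) hp (Eq.symm hq)
      simp [ht, this]
    · have hp' := hp
      obtain ⟨h₂, hp'⟩ := hp'
      have hl₂ := Γ.level_tail e₂
      rw [h₂] at hl₂
      obtain ⟨e₃, h₃, h₃'⟩ := hedge (Γ.head e') (Γ.head e₂) (by omega)
      have hr : Γ.IsPath (Γ.head e') b (e₃ :: p) := ⟨h₃, h₃'.symm ▸ hp'⟩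
      have hqr := ih hq hr hlen.symm (hlen.symm.trans hn)
      rw [List.map_cons, List.prod_cons, List.map_cons, List.prod_cons, List.map_cons,
        List.prod_cons, hqr, List.map_cons, List.prod_cons, ← mul_assoc, ← mul_assoc, ht, h₂, h₃,
        h₃']
      congr 1
      -- Since τ is central, only the sum and the product of the two edge values matter. The sum
      -- telescopes and the product is the diamond relation.
      have hX : ∀ r s : R, (X - C r) * (X - C s) = (X * X - C (r + s) * X + C (r * s) : R[X]) := by
        intro r s
        rw [sub_mul, mul_sub, mul_sub, X_mul_C, C_add, C_mul, add_mul]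
        abel
      rw [hX, hX, hf _ _ (Γ.head e') _ hl (by omega) hl₂]
      congr 4
      abel

theorem coeff_prod_lift {R : Type*} [Ring R] (K : Type w) [Field K] [Algebra K R] (g : Γ.E → R)
    (p : List Γ.E) (k : ℕ) :
    FreeAlgebra.lift K g (Γ.pathCoeff K p k) =
      (p.map fun e => (X - C (g e) : R[X])).prod.coeff (p.length - k) := by
  have : (Γ.pathPoly K p).map (FreeAlgebra.lift K g : FreeAlgebra K Γ.E →+* R) =
      (p.map fun e => (X - C (g e) : R[X])).prod := by
    rw [pathPoly, ← coe_mapRingHom, map_list_prod, List.map_map]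
    congr 2
    ext1 e
    simp
  rw [← this, coeff_map]
  rfl

theorem lift_eq_of_rel {R : Type*} [Ring R] (K : Type w) [Field K] [Algebra K R] {f : Γ.V → R}
    (hedge : ∀ a b, Γ.level a = Γ.level b + 1 → ∃ e, Γ.tail e = a ∧ Γ.head e = b)
    (hf : ∀ a b b' c, Γ.level a = Γ.level b + 1 → Γ.level b' = Γ.level b →
      Γ.level b = Γ.level c + 1 → (f a - f b) * (f b - f c) = (f a - f b') * (f b' - f c))
    {x y : FreeAlgebra K Γ.E} (h : Γ.Rel K x y) :
    FreeAlgebra.lift K (fun e => f (Γ.tail e) - f (Γ.head e)) x =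
      FreeAlgebra.lift K (fun e => f (Γ.tail e) - f (Γ.head e)) y := by
  obtain ⟨a, b, p, q, k, hp, hq, -, -, rfl, rfl⟩ := h
  have hlen : p.length = q.length := by have := hp.level_eq; have := hq.level_eq; omega
  rw [coeff_prod_lift, coeff_prod_lift, prod_map_eq_of_isPath hedge hf hp hq, hlen]

section Algebra

variable (Γ) (K : Type w) [Field K]

/-- The image of an edge in the algebra `A(Γ)`. -/
noncomputable def edge (e : Γ.E) : Γ.Alg K := RingQuot.mkAlgHom K (Γ.Rel K) (FreeAlgebra.ι K e)

open Classical in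
/-- The image in `A(Γ)` of an edge with the given tail and head. -/
noncomputable def edgeBetween (a b : Γ.V) : Γ.Alg K :=
  if h : ∃ e, Γ.tail e = a ∧ Γ.head e = b then Γ.edge K h.choose else 0

/-- The sum of the edges along the path through the vertices `base i, …, base 0`. -/
noncomputable def baseSum (base : ℕ → Γ.V) : ℕ → Γ.Alg K
  | 0 => 0
  | i + 1 => Γ.edgeBetween K (base (i + 1)) (base i) + baseSum base i

/-- The sum of the edges along a path from the given vertex to the bottom. -/
noncomputable def vertexSum (base : ℕ → Γ.V) (a : Γ.V) : Γ.Alg K :=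
  if Γ.level a = 0 then 0
  else Γ.edgeBetween K a (base (Γ.level a - 1)) + Γ.baseSum K base (Γ.level a - 1)

variable {Γ}

theorem mk_pathCoeff_eq {a b : Γ.V} {p q : List Γ.E} (hp : Γ.IsPath a b p) (hq : Γ.IsPath a b q)
    {k : ℕ} (hk : 1 ≤ k) (hkp : k ≤ p.length) :
    RingQuot.mkAlgHom K (Γ.Rel K) (Γ.pathCoeff K p k) =
      RingQuot.mkAlgHom K (Γ.Rel K) (Γ.pathCoeff K q k) :=
  RingQuot.mkAlgHom_rel K ⟨a, b, p, q, k, hp, hq, hk, hkp, rfl, rfl⟩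

theorem edge_relations {e₁ e₂ e₁' e₂' : Γ.E} (h : Γ.head e₁ = Γ.tail e₂)
    (h' : Γ.head e₁' = Γ.tail e₂') (ht : Γ.tail e₁ = Γ.tail e₁') (hh : Γ.head e₂ = Γ.head e₂') :
    Γ.edge K e₁ + Γ.edge K e₂ = Γ.edge K e₁' + Γ.edge K e₂' ∧
      Γ.edge K e₁ * Γ.edge K e₂ = Γ.edge K e₁' * Γ.edge K e₂' := by
  have hp : Γ.IsPath (Γ.tail e₁) (Γ.head e₂) [e₁, e₂] := ⟨rfl, h.symm, rfl⟩
  have hq : Γ.IsPath (Γ.tail e₁) (Γ.head e₂) [e₁', e₂'] := ⟨ht.symm, h'.symm, hh.symm⟩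
  have h1 : ∀ x y : FreeAlgebra K Γ.E, ((X - C x) * (X - C y)).coeff 1 = -(x + y) := by
    intro x y
    rw [sub_mul, mul_sub, mul_sub]
    simp [coeff_X]
    abel
  have h0 : ∀ x y : FreeAlgebra K Γ.E, ((X - C x) * (X - C y)).coeff 0 = x * y := by
    intro x y
    simp [mul_coeff_zero]
  have r1 := mk_pathCoeff_eq K hp hq le_rfl (by simp)
  have r2 := mk_pathCoeff_eq K hp hq one_le_two (by simp)
  simp only [pathCoeff, pathPoly, List.map_cons, List.map_nil, List.prod_cons, List.prod_nil,
    mul_one, List.length_cons, List.length_nil, zero_add, Nat.reduceAdd, Nat.reduceSub, h1, h0,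
    map_neg, neg_inj, map_add, map_mul] at r1 r2
  exact ⟨r1, r2⟩

variable (hedge : ∀ a b, Γ.level a = Γ.level b + 1 → ∃! e, Γ.tail e = a ∧ Γ.head e = b)
include hedge

theorem edgeBetween_tail_head (e : Γ.E) : Γ.edgeBetween K (Γ.tail e) (Γ.head e) = Γ.edge K e := by
  have h : ∃ e', Γ.tail e' = Γ.tail e ∧ Γ.head e' = Γ.head e := ⟨e, rfl, rfl⟩
  rw [edgeBetween, dif_pos h, (hedge _ _ (Γ.level_tail e)).unique h.choose_spec ⟨rfl, rfl⟩]

theorem edgeBetween_relations {a b b' c : Γ.V} (hab : Γ.level a = Γ.level b + 1)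
    (hb : Γ.level b' = Γ.level b) (hbc : Γ.level b = Γ.level c + 1) :
    Γ.edgeBetween K a b + Γ.edgeBetween K b c = Γ.edgeBetween K a b' + Γ.edgeBetween K b' c ∧
      Γ.edgeBetween K a b * Γ.edgeBetween K b c =
        Γ.edgeBetween K a b' * Γ.edgeBetween K b' c := by
  obtain ⟨e₁, ⟨rfl, rfl⟩, -⟩ := hedge a b hab
  obtain ⟨e₂, ⟨h₂, rfl⟩, -⟩ := hedge _ c hbc
  obtain ⟨e₁', ⟨h₁', rfl⟩, -⟩ := hedge _ b' (by omega : Γ.level (Γ.tail e₁) = _)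
  obtain ⟨e₂', ⟨h₂', h₃'⟩, -⟩ := hedge _ (Γ.head e₂) (by omega : Γ.level (Γ.head e₁') = _)
  have := edge_relations K h₂.symm h₂'.symm h₁'.symm h₃'.symm
  simp only [← edgeBetween_tail_head K hedge] at this
  rwa [h₂, h₂', h₁', h₃'] at this

variable {P : PointedLevels Γ.V} (hP : P.level = Γ.level)
include hP

theorem edgeBetween_eq_sub {a b : Γ.V} (h : Γ.level a = Γ.level b + 1) :
    Γ.edgeBetween K a b = Γ.vertexSum K P.base a - Γ.vertexSum K P.base b := by
  have ha : Γ.vertexSum K P.base a =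
      Γ.edgeBetween K a (P.base (Γ.level b)) + Γ.baseSum K P.base (Γ.level b) := by
    simp [vertexSum, h]
  rw [ha]
  -- On level 0 the only vertex is the base. Above it, use the linear relation for the diamond whose
  -- middle vertices are `b` and the base of its level.
  rcases hb : Γ.level b with _ | i
  · rw [← P.eq_base b (by rw [hP, hb])]
    simp [vertexSum, hb, baseSum]
  · have hl : ∀ j ≤ i + 1, Γ.level (P.base j) = j := fun j hj =>
      hP ▸ P.level_base b j (by rw [hP]; omega)
    have := (edgeBetween_relations K hedge (b' := P.base (i + 1)) (c := P.base i) h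
      (by rw [hb, hl _ le_rfl]) (by rw [hb, hl _ (by omega)])).1
    simp only [vertexSum, hb, Nat.succ_ne_zero, if_false, Nat.add_sub_cancel, baseSum]
    rw [← add_assoc, ← this]
    abel

theorem edge_eq_sub (e : Γ.E) :
    Γ.edge K e = Γ.vertexSum K P.base (Γ.tail e) - Γ.vertexSum K P.base (Γ.head e) := by
  rw [← edgeBetween_tail_head K hedge, edgeBetween_eq_sub K hedge hP (Γ.level_tail e)]

theorem diamondFamily_vertexSum : P.DiamondFamily (Γ.vertexSum K P.base) := by
  refine ⟨fun a ha => by simp [vertexSum, ← hP, ha], fun a b b' c hab hb hbc => ?_⟩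
  rw [hP] at hab hb hbc
  have := (edgeBetween_relations K hedge hab hb hbc).2
  rwa [edgeBetween_eq_sub K hedge hP hab, edgeBetween_eq_sub K hedge hP hbc,
    edgeBetween_eq_sub K hedge hP (b := b') (by omega),
    edgeBetween_eq_sub K hedge hP (a := b') (by omega)] at this

end Algebra

end LayeredGraph

/-! ### Normal words and their stability under the operators -/

namespace PointedLevels

open Finsupp

variable {V : Type u} (P : PointedLevels V)

/-- The normal words: all letters have positive level, and no vertex is followed by an extra vertex
of the next lower level. -/
def IsNormal : List V → Prop
  | [] => True
  | v :: ω => 0 < P.level v ∧ ¬ P.BlocksWord v ω ∧ IsNormal ω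

variable (K : Type w) [Field K]

/-- The space with basis the normal words of length `l`. -/
noncomputable def normalSpan (l : ℕ) : Submodule K (List V →₀ K) :=
  supported K K {ω | ω.length = l ∧ P.IsNormal ω}

variable {P}

theorem IsNormal.single_mem {ω : List V} (h : P.IsNormal ω) {l : ℕ} (hl : ω.length = l) :
    single ω 1 ∈ P.normalSpan K l :=
  single_mem_supported K 1 ⟨hl, h⟩

theorem single_cons_mem_normalSpan {v : V} {ω : List V} {l : ℕ} (hv : 0 < P.level v)
    (hb : ¬ P.BlocksWord v ω) (hω : P.IsNormal ω) (hl : ω.length + 1 = l) :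
    single (v :: ω) 1 ∈ P.normalSpan K l :=
  IsNormal.single_mem K (ω := v :: ω) ⟨hv, hb, hω⟩ hl

theorem map_mem_of_mem_normalSpan {M : Type*} [AddCommGroup M] [Module K M]
    (T : (List V →₀ K) →ₗ[K] M) (N : Submodule K M) {l : ℕ}
    (h : ∀ ω : List V, ω.length = l → P.IsNormal ω → T (single ω 1) ∈ N)
    {x : List V →₀ K} (hx : x ∈ P.normalSpan K l) : T x ∈ N := by
  have : P.normalSpan K l ≤ N.comap T := by
    rw [normalSpan, supported_eq_span_single, Submodule.span_le]
    rintro _ ⟨ω, ⟨h1, h2⟩, rfl⟩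
    exact h ω h1 h2
  exact this hx

theorem extraOp_mem_normalSpan {v : V} (hv : P.IsExtra v) {l : ℕ} {x : List V →₀ K}
    (hx : x ∈ P.normalSpan K l) : P.extraOp K v x ∈ P.normalSpan K (l + 1) := by
  refine map_mem_of_mem_normalSpan K _ _ (fun ω hl hω => ?_) hx
  by_cases h : P.BlocksWord v ω
  · rw [P.extraOp_of_blocks K h]
    exact zero_mem _
  · rw [P.extraOp_of_not_blocks K h]
    exact single_cons_mem_normalSpan K hv.level_pos h hω (by simp [hl])

theorem baseWord_mem_normalSpan {ω : List V} (hω : P.IsNormal ω) {v : V} {i : ℕ}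
    (hi : i ≤ P.level v) : P.baseWord K ω i ∈ P.normalSpan K (ω.length + 1) := by
  induction ω generalizing i with
  | nil =>
    have hlev := P.level_base v i hi
    rcases Nat.eq_zero_or_pos i with rfl | h0
    · simp
    · have := P.baseWord_of_not_blocks K (v := P.base i) (ω := []) (by omega) (by simp)
      rw [hlev] at this
      rw [this]
      exact single_cons_mem_normalSpan K (by omega) (by simp) trivial rfl
  | cons w ω ih =>
    have hlev := P.level_base v i hi
    rcases Nat.eq_zero_or_pos i with rfl | h0
    · simp
    by_cases h : P.Blocks (P.base i) w
    · have := P.baseWord_of_blocks K ω h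
      rw [hlev] at this
      rw [this]
      have hw := h.2.level_pos
      have hb := P.level_base w _ le_rfl
      have h1 : P.level w + 1 = i := by rw [← h.1, hlev]
      have hbω : ¬ P.BlocksWord (P.base (P.level w)) ω := by
        have := hω.2.1
        simpa only [BlocksWord, Blocks, hb] using this
      refine sub_mem (add_mem (add_mem ?_ ?_) ?_)
        (extraOp_mem_normalSpan K h.2 (ih hω.2.2 (by omega)))
      · exact single_cons_mem_normalSpan K (by omega)
          (by simpa using P.not_blocks_of_level_eq hb) hω (by simp)
      · exact single_cons_mem_normalSpan K hw
          (by simpa using P.not_blocks_of_level_eq hb.symm)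
          (show P.IsNormal (_ :: ω) from ⟨by omega, hbω, hω.2.2⟩) (by simp)
      · exact single_cons_mem_normalSpan K hw
          (by simpa using P.not_blocks_of_level_eq rfl) hω (by simp)
    · have := P.baseWord_of_not_blocks K (v := P.base i) (ω := w :: ω) (by omega) (by simpa using h)
      rw [hlev] at this
      rw [this]
      exact single_cons_mem_normalSpan K (by omega) (by simpa using h) hω (by simp)

theorem vertexOp_mem_normalSpan (v : V) {l : ℕ} {x : List V →₀ K}
    (hx : x ∈ P.normalSpan K l) : P.vertexOp K v x ∈ P.normalSpan K (l + 1) := by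
  have hb : P.baseOp K (P.level v) x ∈ P.normalSpan K (l + 1) := by
    refine map_mem_of_mem_normalSpan K _ _ (fun ω hl hω => ?_) hx
    rw [P.baseOp_single, ← hl]
    exact baseWord_mem_normalSpan K hω (v := v) le_rfl
  by_cases hv : P.IsExtra v
  · simp only [vertexOp, hv, if_true, LinearMap.add_apply]
    exact add_mem hb (extraOp_mem_normalSpan K hv hx)
  · simpa only [vertexOp, hv, if_false, add_zero] using hb

/-- On a word that stays normal no rewriting occurs, so a letter is simply prepended. Hence every
normal word is reached from the empty one. -/
theorem letter_vertexOp {v : V} {ω : List V} (h : P.IsNormal (v :: ω)) :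
    P.letter (P.vertexOp K) v (single ω 1) = single (v :: ω) 1 := by
  have hbv := P.level_base v _ le_rfl
  have hbase : P.vertexOp K (P.base (P.level v)) = P.baseOp K (P.level v) := by
    simp [vertexOp, P.not_isExtra_base (le_refl (P.level v)), hbv]
  by_cases hv : P.IsExtra v
  · rw [P.letter_of_isExtra _ hv, hbase]
    simp only [vertexOp, hv, if_true, LinearMap.sub_apply, LinearMap.add_apply, add_sub_cancel_left]
    exact P.extraOp_of_not_blocks K h.2.1
  · have hveq : v = P.base (P.level v) := not_not.1 hv
    rw [letter, if_neg hv, hveq, hbase, P.baseOp_single, P.baseWord_of_not_blocks K h.1 h.2.1]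

variable (P) in
theorem finrank_normalSpan (l : ℕ) :
    Module.finrank K (P.normalSpan K l) = Nat.card {ω : List V // ω.length = l ∧ P.IsNormal ω} := by
  rw [normalSpan, (supportedEquivFinsupp (M := K) (R := K) _).finrank_eq]
  exact Module.finrank_eq_nat_card_basis (Finsupp.basisSingleOne)

end PointedLevels

/-! ### The action of A(Γ) and the normal form -/

namespace LayeredGraph

open Finsupp

variable {Γ : LayeredGraph.{u, v}} (K : Type w) [Field K]
  (hedge : ∀ a b, Γ.level a = Γ.level b + 1 → ∃! e, Γ.tail e = a ∧ Γ.head e = b)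
  {P : PointedLevels Γ.V} (hP : P.level = Γ.level)

/-- The action of `A(Γ)` on the space with basis the normal words. -/
noncomputable def wordRep : Γ.Alg K →ₐ[K] Module.End K (List Γ.V →₀ K) :=
  RingQuot.liftAlgHom K ⟨FreeAlgebra.lift K fun e =>
    P.vertexOp K (Γ.tail e) - P.vertexOp K (Γ.head e), fun _ _ h => by
      refine lift_eq_of_rel K (f := P.vertexOp K) (fun a b hab => (hedge a b hab).exists) ?_ h
      simpa only [hP] using (P.diamondFamily_vertexOp K).diamond⟩

theorem wordRep_edge (e : Γ.E) : wordRep K hedge hP (Γ.edge K e) =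
    P.vertexOp K (Γ.tail e) - P.vertexOp K (Γ.head e) := by
  simp [wordRep, edge]

theorem wordRep_edgeBetween {a b : Γ.V} (h : Γ.level a = Γ.level b + 1) :
    wordRep K hedge hP (Γ.edgeBetween K a b) = P.vertexOp K a - P.vertexOp K b := by
  obtain ⟨e, ⟨rfl, rfl⟩, -⟩ := hedge a b h
  rw [edgeBetween_tail_head K hedge, wordRep_edge]

theorem wordRep_baseSum {a : Γ.V} {i : ℕ} (hi : i ≤ Γ.level a) :
    wordRep K hedge hP (Γ.baseSum K P.base i) = P.vertexOp K (P.base i) := by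
  have hl : ∀ j ≤ i, Γ.level (P.base j) = j := fun j hj =>
    hP ▸ P.level_base a j (by rw [hP]; omega)
  induction i with
  | zero =>
    rw [baseSum, map_zero, (P.diamondFamily_vertexOp K).zero _ (by rw [hP, hl 0 le_rfl])]
  | succ i ih =>
    rw [baseSum, map_add, ih (by omega) fun j hj => hl j (by omega),
      wordRep_edgeBetween K hedge hP (by rw [hl _ le_rfl, hl i (by omega)])]
    exact sub_add_cancel (G := Module.End K (List Γ.V →₀ K)) _ _

theorem wordRep_vertexSum (a : Γ.V) :
    wordRep K hedge hP (Γ.vertexSum K P.base a) = P.vertexOp K a := by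
  rcases h : Γ.level a with _ | i
  · rw [(P.diamondFamily_vertexOp K).zero a (by rw [hP, h])]
    simp [vertexSum, h]
  · have hl : Γ.level (P.base i) = i := hP ▸ P.level_base a i (by rw [hP]; omega)
    simp only [vertexSum, h, Nat.succ_ne_zero, if_false, Nat.add_sub_cancel, map_add]
    rw [wordRep_baseSum K hedge hP (a := a) (by omega),
      wordRep_edgeBetween K hedge hP (by rw [h, hl])]
    exact sub_add_cancel (G := Module.End K (List Γ.V →₀ K)) _ _

theorem wordRep_letter (a : Γ.V) :
    wordRep K hedge hP (P.letter (Γ.vertexSum K P.base) a) = P.letter (P.vertexOp K) a := by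
  unfold PointedLevels.letter
  split_ifs <;> simp only [map_sub, wordRep_vertexSum]

/-- Evaluation is A(Γ)-linear. At the empty word, whose value is 1, this makes it a left inverse of
the normal form. -/
theorem evalWords_wordRep (a : Γ.Alg K) (x : List Γ.V →₀ K) :
    P.evalWords K (Γ.vertexSum K P.base) (wordRep K hedge hP a x) =
      a * P.evalWords K (Γ.vertexSum K P.base) x := by
  obtain ⟨y, rfl⟩ := RingQuot.mkAlgHom_surjective K (Γ.Rel K) a
  have hf := diamondFamily_vertexSum K hedge hP
  induction y using FreeAlgebra.induction generalizing x with
  | grade0 r =>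
    rw [AlgHom.commutes, AlgHom.commutes, ← Algebra.smul_def]
    simp
  | grade1 e =>
    have he : RingQuot.mkAlgHom K (Γ.Rel K) (FreeAlgebra.ι K e) = Γ.edge K e := rfl
    rw [he, wordRep_edge, LinearMap.sub_apply, map_sub, hf.evalWords_vertexOp K,
      hf.evalWords_vertexOp K, ← sub_mul, edge_eq_sub K hedge hP e]
  | mul a b ha hb =>
    rw [map_mul, map_mul, Module.End.mul_apply, ha, hb, mul_assoc]
  | add a b ha hb =>
    rw [map_add, map_add, LinearMap.add_apply, map_add, ha, hb, add_mul]

/-- The normal form of an element of `A(Γ)`. -/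
noncomputable def normalForm : Γ.Alg K →ₗ[K] (List Γ.V →₀ K) :=
  LinearMap.applyₗ (single [] 1) ∘ₗ (wordRep K hedge hP).toLinearMap

theorem normalForm_mul (a b : Γ.Alg K) :
    normalForm K hedge hP (a * b) = wordRep K hedge hP a (normalForm K hedge hP b) := by
  simp [normalForm]

theorem normalForm_one : normalForm K hedge hP 1 = single [] 1 := by
  simp [normalForm]

theorem normalForm_injective : Function.Injective (normalForm K hedge hP) := by
  refine Function.LeftInverse.injective (g := P.evalWords K (Γ.vertexSum K P.base)) fun a => ?_
  change P.evalWords K _ (wordRep K hedge hP a (single [] 1)) = a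
  rw [evalWords_wordRep, P.evalWords_single]
  simp

theorem edge_mul_mem_degree (e : Γ.E) {l : ℕ} {x : Γ.Alg K} (hx : x ∈ Γ.degree K l) :
    Γ.edge K e * x ∈ Γ.degree K (l + 1) := by
  obtain ⟨y, hy, rfl⟩ := hx
  refine ⟨FreeAlgebra.ι K e * y, ?_, by simp [edge]⟩
  have : freeDegree K Γ.E l ≤
      (freeDegree K Γ.E (l + 1)).comap (LinearMap.mulLeft K (FreeAlgebra.ι K e)) := by
    refine Submodule.span_le.2 ?_
    rintro _ ⟨p, hp, rfl⟩
    exact Submodule.subset_span ⟨e :: p, by simp [hp], by simp⟩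
  exact this hy

theorem letter_mul_mem_degree (base : ℕ → Γ.V) (a : Γ.V) {l : ℕ} {x : Γ.Alg K}
    (hx : x ∈ Γ.degree K l) :
    P.letter (Γ.vertexSum K base) a * x ∈ Γ.degree K (l + 1) := by
  have hb : ∀ a b, Γ.edgeBetween K a b * x ∈ Γ.degree K (l + 1) := by
    intro a b
    unfold edgeBetween
    split_ifs
    · exact edge_mul_mem_degree K _ hx
    · simp
  have hs : ∀ i, Γ.baseSum K base i * x ∈ Γ.degree K (l + 1) := by
    intro i
    induction i with
    | zero => simp [baseSum]
    | succ i ih => rw [baseSum, add_mul]; exact add_mem (hb _ _) ih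
  have hv : ∀ a, Γ.vertexSum K base a * x ∈ Γ.degree K (l + 1) := by
    intro a
    unfold vertexSum
    split_ifs
    · simp
    · rw [add_mul]; exact add_mem (hb _ _) (hs _)
  unfold PointedLevels.letter
  split_ifs
  · rw [sub_mul]; exact sub_mem (hv _) (hv _)
  · exact hv _

/-- Each edge acts within normal words and raises length by one; conversely, a normal word is the
normal form of the product of its letters, each homogeneous of degree one. -/
theorem map_normalForm_degree (l : ℕ) :
    (Γ.degree K l).map (normalForm K hedge hP) = P.normalSpan K l := by
  apply le_antisymm
  · rw [degree, freeDegree, Submodule.map_span, Submodule.map_span, Submodule.span_le]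
    rintro _ ⟨_, ⟨_, ⟨p, hp, rfl⟩, rfl⟩, rfl⟩
    induction p generalizing l with
    | nil =>
      simp only [List.map_nil, List.prod_nil, AlgHom.toLinearMap_apply, map_one, normalForm_one]
      exact PointedLevels.IsNormal.single_mem K (ω := []) trivial hp
    | cons e p ih =>
      subst hp
      simp only [List.map_cons, List.prod_cons, AlgHom.toLinearMap_apply, map_mul, normalForm_mul]
      change wordRep K hedge hP (Γ.edge K e) _ ∈ _
      rw [wordRep_edge, LinearMap.sub_apply]
      exact sub_mem (PointedLevels.vertexOp_mem_normalSpan K _ (ih _ rfl))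
        (PointedLevels.vertexOp_mem_normalSpan K _ (ih _ rfl))
  · intro x hx
    refine PointedLevels.map_mem_of_mem_normalSpan K LinearMap.id _ (fun ω hl hω => ?_) hx
    rw [LinearMap.id_apply]
    induction ω generalizing l x with
    | nil =>
      subst hl
      refine ⟨1, ⟨1, Submodule.subset_span ⟨[], rfl, by simp⟩, by simp⟩, normalForm_one K hedge hP⟩
    | cons v ω ih =>
      subst hl
      obtain ⟨y, hy, hyω⟩ :=
        ih _ (PointedLevels.IsNormal.single_mem K (ω := ω) hω.2.2 rfl) rfl hω.2.2
      refine ⟨_, letter_mul_mem_degree K (P := P) P.base v hy, ?_⟩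
      rw [normalForm_mul, hyω, wordRep_letter, PointedLevels.letter_vertexOp K hω]

include hedge hP in
theorem finrank_degree (l : ℕ) : Module.finrank K (Γ.degree K l) =
    Nat.card {ω : List Γ.V // ω.length = l ∧ P.IsNormal ω} := by
  rw [← P.finrank_normalSpan K, ← map_normalForm_degree K hedge hP]
  exact (Submodule.equivMapOfInjective _ (normalForm_injective K hedge hP) _).finrank_eq

end LayeredGraph

/-! ### Counting normal words by first letter -/

namespace PointedLevels

variable {V : Type u} (P : PointedLevels V) [Fintype V]

open Classical in
/-- The vertices of positive level that can follow the given vertex in a normal word. -/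
noncomputable def followers (v : V) : Finset V := {w | 0 < P.level w ∧ ¬ P.Blocks v w}

open Classical in
/-- The normal words of length `l` whose first letter, if any, lies in `S`. -/
noncomputable def normalWords : ℕ → Finset V → Finset (List V)
  | 0, _ => {[]}
  | l + 1, S => S.biUnion fun v => (normalWords l (P.followers v)).image (List.cons v)

theorem mem_normalWords {l : ℕ} {S : Finset V} (hS : ∀ v ∈ S, 0 < P.level v) {ω : List V} :
    ω ∈ P.normalWords l S ↔ ω.length = l ∧ P.IsNormal ω ∧ ∀ v ∈ ω.head?, v ∈ S := by
  induction l generalizing S ω with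
  | zero =>
    simp only [normalWords, Finset.mem_singleton, List.length_eq_zero_iff]
    constructor
    · rintro rfl; simp [IsNormal]
    · exact fun h => h.1
  | succ l ih =>
    have hfol : ∀ v, ∀ w ∈ P.followers v, 0 < P.level w := fun v w hw => by
      simp only [followers, Finset.mem_filter] at hw; exact hw.2.1
    simp only [normalWords, Finset.mem_biUnion, Finset.mem_image, ih (hfol _)]
    constructor
    · rintro ⟨v, hv, ω, ⟨hl, hω, hh⟩, rfl⟩
      refine ⟨by simp [hl], ⟨hS v hv, ?_, hω⟩, by simpa using hv⟩
      rintro ⟨w, hw, hb⟩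
      have := hh w hw
      simp only [followers, Finset.mem_filter] at this
      exact this.2.2 hb
    · rintro ⟨hl, hω, hh⟩
      obtain _ | ⟨v, ω⟩ := ω
      · simp at hl
      refine ⟨v, hh v rfl, ω, ⟨by simpa using hl, hω.2.2, fun w hw => ?_⟩, rfl⟩
      simp only [followers, Finset.mem_filter, Finset.mem_univ, true_and]
      refine ⟨?_, fun hb => hω.2.1 ⟨w, hw, hb⟩⟩
      obtain _ | ⟨y, ω⟩ := ω
      · simp at hw
      · obtain rfl : y = w := by simpa using hw
        exact hω.2.2.1

theorem card_normalWords_succ (l : ℕ) (S : Finset V) :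
    (P.normalWords (l + 1) S).card = ∑ v ∈ S, (P.normalWords l (P.followers v)).card := by
  classical
  rw [normalWords, Finset.card_biUnion]
  · exact Finset.sum_congr rfl fun v _ =>
      Finset.card_image_of_injective _ (List.cons_injective)
  · intro v _ w _ hvw
    rw [Function.onFun, Finset.disjoint_left]
    rintro _ h1 h2
    simp only [Finset.mem_image] at h1 h2
    obtain ⟨ω, -, rfl⟩ := h1
    obtain ⟨ω', -, h⟩ := h2
    exact hvw (List.cons.inj h).1.symm

open PowerSeries

/-- The generating series of the normal words whose first letter, if any, lies in `S`. -/
noncomputable def wordSeries (S : Finset V) : PowerSeries ℚ :=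
  PowerSeries.mk fun l => ((P.normalWords l S).card : ℚ)

theorem wordSeries_eq (S : Finset V) :
    P.wordSeries S = 1 + X * ∑ v ∈ S, P.wordSeries (P.followers v) := by
  ext l
  cases l with
  | zero => simp [wordSeries, normalWords]
  | succ l =>
    rw [map_add, coeff_succ_X_mul, map_sum]
    simp [wordSeries, card_normalWords_succ, coeff_one]

end PointedLevels

/-! ### The generating series in closed form -/

section ChainSeries

open PowerSeries

/-- The series `∑ₖ (-1)ᵏ (mᵢ₋₁ - 1) ⋯ (mᵢ₋ₖ - 1) tᵏ`. -/
noncomputable def chainSeries (m : ℕ → ℕ) : ℕ → PowerSeries ℚ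
  | 0 => 1
  | i + 1 => 1 - C ((m i : ℚ) - 1) * X * chainSeries m i

theorem chainSeries_eq_sum (m : ℕ → ℕ) (i : ℕ) :
    chainSeries m i = ∑ k ∈ Finset.range (i + 1),
      C ((-1) ^ k * ∏ j ∈ Finset.Ico 1 (k + 1), ((m (i - j) : ℚ) - 1)) * X ^ k := by
  induction i with
  | zero => simp [chainSeries]
  | succ i ih =>
    rw [Finset.sum_range_succ', chainSeries, ih, Finset.mul_sum, sub_eq_neg_add,
      ← Finset.sum_neg_distrib]
    congr 1
    · refine Finset.sum_congr rfl fun k _ => ?_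
      rw [Finset.prod_eq_prod_Ico_succ_bot (by omega : 1 < k + 1 + 1),
        ← Finset.prod_Ico_add' _ 1 (k + 1) 1, Nat.add_sub_cancel]
      simp only [Nat.add_sub_add_right]
      simp only [map_mul, map_pow, map_neg, map_one]
      ring
    · simp

/-- Splitting the last factor as (m - 1) + 1 writes each summand through two consecutive terms of
`chainSeries`; the sum then collapses to a multiple of 1 - t. -/
theorem sum_layerProd_eq (m : ℕ → ℕ) (hm : m 0 = 1) {a : ℕ} (ha : 0 < a) :
    ∑ k ∈ Finset.range (a + 1), C ((-1) ^ k * layerProd m k a) * X ^ (k + 1) =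
      (1 - X) * X * (C (m a : ℚ) * chainSeries m a) := by
  set F : ℕ → PowerSeries ℚ := fun k =>
    C ((-1) ^ k * ∏ j ∈ Finset.Ico 1 (k + 1), ((m (a - j) : ℚ) - 1)) * X ^ k with hF
  -- The top term contains m_0 - 1 = 0, so both index ranges below give the full series.
  have hFa : F a = 0 := by
    have : ∏ j ∈ Finset.Ico 1 (a + 1), ((m (a - j) : ℚ) - 1) = 0 :=
      Finset.prod_eq_zero (i := a) (by simp; omega) (by simp [hm])
    simp only [hF, this, mul_zero, map_zero, zero_mul]
  have h1 : chainSeries m a = ∑ k ∈ Finset.range a, F (k + 1) + F 0 := by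
    rw [chainSeries_eq_sum, Finset.sum_range_succ']
  have h2 : chainSeries m a = ∑ k ∈ Finset.range a, F k := by
    rw [chainSeries_eq_sum, Finset.sum_range_succ, ← hF]
    change _ + F a = _
    rw [hFa, add_zero]
  have hterm : ∀ k, C ((-1) ^ (k + 1) * layerProd m (k + 1) a) * X ^ (k + 1 + 1) =
      C (m a : ℚ) * X * F (k + 1) - C (m a : ℚ) * X * X * F k := by
    intro k
    simp only [hF, layerProd, Nat.succ_ne_zero, if_false]
    rw [Finset.prod_Ico_succ_top (by omega : 1 ≤ k + 1)]
    simp only [map_mul, map_pow, map_neg, map_one, map_sub]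
    ring
  rw [Finset.sum_range_succ', Finset.sum_congr rfl fun k _ => hterm k, Finset.sum_sub_distrib,
    ← Finset.mul_sum, ← Finset.mul_sum, ← h2, eq_sub_of_add_eq h1.symm]
  simp [hF, layerProd]
  ring

theorem one_sub_sum_layerProd (m : ℕ → ℕ) (hm : m 0 = 1) (n : ℕ) :
    1 - ∑ k ∈ Finset.range (n + 1), ∑ a ∈ Finset.Icc k n,
        C ((-1) ^ k * layerProd m k a) * X ^ (k + 1) =
      (1 - X) * (1 - X * ∑ a ∈ Finset.Icc 1 n, C (m a : ℚ) * chainSeries m a) := by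
  rw [Finset.sum_comm' (t' := Finset.range (n + 1)) (s' := fun a => Finset.range (a + 1))
    (by intro k a; simp only [Finset.mem_range, Finset.mem_Icc]; omega)]
  rw [Finset.sum_range_eq_add_Ico _ (by omega : 0 < n + 1)]
  have : Finset.Icc 1 n = Finset.Ico 1 (n + 1) := by
    ext; simp only [Finset.mem_Icc, Finset.mem_Ico]; omega
  rw [this, Finset.sum_congr rfl fun a ha =>
    sum_layerProd_eq m hm (by simp only [Finset.mem_Ico] at ha; omega),
    ← Finset.mul_sum]
  simp [layerProd, hm]
  ring

namespace PointedLevels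

variable {V : Type u} (P : PointedLevels V) [Fintype V]

variable {P} in
open Classical in
theorem card_blocked_followers {n : ℕ} {m : ℕ → ℕ} (hn : ∀ v, P.level v ≤ n)
    (hcard : ∀ i ≤ n, (Finset.univ.filter fun v => P.level v = i).card = m i) {v : V} {i : ℕ}
    (hv : P.level v = i + 1) :
    (((Finset.univ.filter fun w => 0 < P.level w ∧ P.Blocks v w).card : ℕ) : ℚ) = m i - 1 := by
  have hb := P.level_base v i (by omega)
  have : (Finset.univ.filter fun w => 0 < P.level w ∧ P.Blocks v w) =
      (Finset.univ.filter fun w => P.level w = i).erase (P.base i) := by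
    ext w
    simp only [Finset.mem_filter, Finset.mem_univ, true_and, Finset.mem_erase, Blocks, hv]
    constructor
    · rintro ⟨-, h1, h2⟩
      have : P.level w = i := by omega
      exact ⟨this ▸ h2, this⟩
    · rintro ⟨h1, rfl⟩
      exact ⟨IsExtra.level_pos h1, rfl, h1⟩
  have hmem : P.base i ∈ Finset.univ.filter fun w => P.level w = i := by simp [hb]
  rw [this, Finset.card_erase_of_mem hmem, Nat.cast_sub (Finset.card_pos.2 ⟨_, hmem⟩),
    hcard i (by have := hn v; omega), Nat.cast_one]

-- Let W count all normal words and W_v those allowed after v, with |v| = i + 1. Subtracting the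
-- first-letter equations gives W_v = W - t ∑ W_w over the m_i - 1 blocked w, all of level i; this
-- is the recursion of `chainSeries`.
open Classical in
theorem wordSeries_followers {n : ℕ} {m : ℕ → ℕ} (hn : ∀ v, P.level v ≤ n)
    (hcard : ∀ i ≤ n, (Finset.univ.filter fun v => P.level v = i).card = m i) (v : V)
    (hv : 0 < P.level v) :
    P.wordSeries (P.followers v) =
      P.wordSeries {w | 0 < P.level w} * chainSeries m (P.level v) := by
  obtain ⟨i, hi⟩ : ∃ i, P.level v = i + 1 := ⟨P.level v - 1, by omega⟩
  induction i using Nat.strong_induction_on generalizing v with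
  | _ i ih =>
    have hblocked : ∑ w ∈ Finset.univ.filter fun w => 0 < P.level w ∧ P.Blocks v w,
        P.wordSeries (P.followers w) =
          C ((m i : ℚ) - 1) * (P.wordSeries {w | 0 < P.level w} * chainSeries m i) := by
      have : ∀ w ∈ Finset.univ.filter fun w => 0 < P.level w ∧ P.Blocks v w,
          P.wordSeries (P.followers w) =
            P.wordSeries {w | 0 < P.level w} * chainSeries m i := by
        intro w hw
        simp only [Finset.mem_filter, Finset.mem_univ, true_and] at hw
        have h1 := hw.2.1
        have h2 : P.level w = i := by omega
        rw [ih (i - 1) (by omega) w hw.1 (by omega), h2]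
      rw [Finset.sum_congr rfl this, Finset.sum_const, nsmul_eq_mul,
        ← card_blocked_followers hn hcard hi, map_natCast]
    have hsplit := Finset.sum_filter_add_sum_filter_not
      (Finset.univ.filter fun w => 0 < P.level w) (fun w => P.Blocks v w)
      (fun w => P.wordSeries (P.followers w))
    rw [Finset.filter_filter, Finset.filter_filter, hblocked] at hsplit
    have h1 := P.wordSeries_eq (P.followers v)
    have h2 := P.wordSeries_eq {w | 0 < P.level w}
    rw [← hsplit] at h2
    rw [h1, hi, chainSeries]
    change 1 + X * ∑ w ∈ Finset.univ.filter fun w => 0 < P.level w ∧ ¬ P.Blocks v w, _ = _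
    linear_combination -h2

open Classical in
theorem wordSeries_mul_eq_one {n : ℕ} {m : ℕ → ℕ} (hn : ∀ v, P.level v ≤ n)
    (hcard : ∀ i ≤ n, (Finset.univ.filter fun v => P.level v = i).card = m i) :
    P.wordSeries {w | 0 < P.level w} *
      (1 - X * ∑ a ∈ Finset.Icc 1 n, C (m a : ℚ) * chainSeries m a) = 1 := by
  have h := P.wordSeries_eq {w | 0 < P.level w}
  have hsum : ∑ v ∈ Finset.univ.filter fun w => 0 < P.level w, P.wordSeries (P.followers v) =
      P.wordSeries {w | 0 < P.level w} *
        ∑ a ∈ Finset.Icc 1 n, C (m a : ℚ) * chainSeries m a := by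
    rw [Finset.mul_sum, ← Finset.sum_fiberwise_of_maps_to (t := Finset.Icc 1 n) (g := P.level)
      (fun v hv => by
        simp only [Finset.mem_filter, Finset.mem_univ, true_and] at hv
        exact Finset.mem_Icc.2 ⟨hv, hn v⟩)]
    refine Finset.sum_congr rfl fun a ha => ?_
    rw [Finset.mem_Icc] at ha
    have hS : ((Finset.univ.filter fun w => 0 < P.level w).filter fun w => P.level w = a) =
        Finset.univ.filter fun w => P.level w = a := by
      ext w
      simp only [Finset.mem_filter, Finset.mem_univ, true_and]
      omega
    have hval : ∀ w ∈ Finset.univ.filter fun w => P.level w = a,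
        P.wordSeries (P.followers w) =
          P.wordSeries {w | 0 < P.level w} * chainSeries m a := by
      intro w hw
      simp only [Finset.mem_filter, Finset.mem_univ, true_and] at hw
      rw [P.wordSeries_followers hn hcard w (by omega), hw]
    rw [hS, Finset.sum_congr rfl hval, Finset.sum_const, hcard a ha.2, nsmul_eq_mul, map_natCast]
    ring
  rw [hsum] at h
  linear_combination h

end PointedLevels

end ChainSeries

/-! ### Complete layered graphs -/

namespace LayeredGraph

variable {Γ : LayeredGraph.{u, v}}

theorem IsComplete.finite {n : ℕ} {m : ℕ → ℕ} (hΓ : Γ.IsComplete n m) : Finite Γ.V := by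
  have : (Set.univ : Set Γ.V) = ⋃ i ∈ Finset.range (n + 1), {a | Γ.level a = i} := by
    ext a
    simp only [Set.mem_univ, Set.mem_iUnion, Set.mem_ofPred_eq, true_iff]
    exact ⟨_, Finset.mem_range.2 (Nat.lt_succ_of_le (hΓ.level_le a)), rfl⟩
  rw [← Set.finite_univ_iff, this]
  refine Set.Finite.biUnion (Finset.finite_toSet _) fun i hi => ?_
  refine Set.finite_of_encard_eq_coe (k := m i) (hΓ.card_level i ?_)
  have := Finset.mem_range.1 hi
  omega

theorem IsComplete.exists_pointedLevels {n : ℕ} {m : ℕ → ℕ} (hm : m 0 = 1)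
    (hΓ : Γ.IsComplete n m) (hout : ∀ a, 0 < Γ.level a → ∃ e, Γ.tail e = a) :
    ∃ P : PointedLevels Γ.V, P.level = Γ.level := by
  classical
  obtain ⟨c, hc⟩ := Set.encard_eq_one.1 (by rw [hΓ.card_level 0 (Nat.zero_le n), hm]; rfl)
  have hc' : ∀ a, Γ.level a = 0 ↔ a = c := fun a =>
    Set.ext_iff.1 hc a
  have hne : ∀ a i, i ≤ Γ.level a → ∃ b, Γ.level b = i := by
    intro a i hi
    induction h : Γ.level a generalizing a with
    | zero => exact ⟨a, by omega⟩
    | succ k ih =>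
      rcases Nat.lt_or_ge i (k + 1) with h1 | h1
      · obtain ⟨e, rfl⟩ := hout a (by omega)
        have := Γ.level_tail e
        exact ih (Γ.head e) (by omega) (by omega)
      · exact ⟨a, by omega⟩
  -- Following outgoing edges downward shows that every level below a vertex is nonempty, so the
  -- default `c` is never tested.
  refine ⟨⟨Γ.level, fun i => if h : ∃ b, Γ.level b = i then h.choose else c, ?_, ?_⟩, rfl⟩
  · intro a i hi
    have h := hne a i hi
    simp only [dif_pos h]
    exact h.choose_spec
  · intro a ha
    have h : ∃ b, Γ.level b = 0 := ⟨a, ha⟩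
    simp only [dif_pos h]
    rw [(hc' a).1 ha, (hc' _).1 h.choose_spec]

theorem IsComplete.hilbertSeries_mul (K : Type w) [Field K] {n : ℕ} {m : ℕ → ℕ} (hm : m 0 = 1)
    (hΓ : Γ.IsComplete n m) (hout : ∀ a, 0 < Γ.level a → ∃ e, Γ.tail e = a) :
    hilbertSeries (Γ.degree K) *
      (1 - PowerSeries.X * ∑ a ∈ Finset.Icc 1 n,
        PowerSeries.C (m a : ℚ) * chainSeries m a) = 1 := by
  classical
  obtain ⟨P, hP⟩ := hΓ.exists_pointedLevels hm hout
  have := hΓ.finite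
  have := Fintype.ofFinite Γ.V
  have hcard : ∀ i ≤ n, (Finset.univ.filter fun v => P.level v = i).card = m i := by
    intro i hi
    have h := hΓ.card_level i hi
    rw [Set.encard_eq_coe_toFinset_card, Set.toFinset_ofPred] at h
    rw [hP]
    exact_mod_cast h
  refine Eq.trans ?_ (P.wordSeries_mul_eq_one (fun v => hP ▸ hΓ.level_le v) hcard)
  congr 1
  ext l
  have hpos : ∀ v ∈ Finset.univ.filter fun w => 0 < P.level w, 0 < P.level v := fun v hv => by
    simpa using hv
  rw [hilbertSeries, PointedLevels.wordSeries, PowerSeries.coeff_mk, PowerSeries.coeff_mk,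
    finrank_degree K hΓ.existsUnique_edge hP]
  congr 1
  exact Nat.subtype_card _ fun ω => by
    rw [P.mem_normalWords hpos]
    refine ⟨fun h => ⟨h.1, h.2.1⟩, fun h => ⟨h.1, h.2, ?_⟩⟩
    obtain _ | ⟨v, ω⟩ := ω
    · simp
    · simpa using h.2.1

/-- If all levels have one vertex, the defining relations are trivial. -/
theorem eq_of_rel {K : Type w} [Field K]
    (hedge : ∀ a b, Γ.level a = Γ.level b + 1 → ∃! e, Γ.tail e = a ∧ Γ.head e = b)
    (hinj : Function.Injective Γ.level) {x y : FreeAlgebra K Γ.E} (h : Γ.Rel K x y) : x = y := by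
  obtain ⟨a, b, p, q, k, hp, hq, -, -, rfl, rfl⟩ := h
  suffices p = q by rw [this]
  have hlen : p.length = q.length := by have := hp.level_eq; have := hq.level_eq; omega
  induction p generalizing a q with
  | nil => exact (List.eq_nil_of_length_eq_zero hlen.symm).symm
  | cons e p ih =>
    obtain _ | ⟨e', q⟩ := q
    · simp at hlen
    obtain ⟨rfl, hp⟩ := hp
    obtain ⟨ht, hq⟩ := hq
    have hh : Γ.head e = Γ.head e' := hinj (by
      have h1 := Γ.level_tail e
      have h2 := Γ.level_tail e'
      rw [ht] at h2
      omega)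
    obtain rfl : e = e' := (hedge _ _ (Γ.level_tail e)).unique ⟨rfl, rfl⟩ ⟨ht, hh.symm⟩
    rw [ih _ _ hp hq (by simpa using hlen)]

end LayeredGraph

/-! ### Singleton levels and the free algebra -/

theorem map_equiv_freeDegree (K : Type w) [Field K] {E : Type u} {F : Type v} (g : E ≃ F)
    (i : ℕ) : (freeDegree K E i).map
      (FreeAlgebra.lift K (FreeAlgebra.ι K ∘ g)).toLinearMap = freeDegree K F i := by
  rw [freeDegree, Submodule.map_span, freeDegree]
  congr 1
  ext x
  constructor
  · rintro ⟨_, ⟨l, hl, rfl⟩, rfl⟩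
    refine ⟨l.map g, by simpa using hl, ?_⟩
    simp [map_list_prod, Function.comp_def]
  · rintro ⟨l, hl, rfl⟩
    refine ⟨_, ⟨l.map g.symm, by simpa using hl, rfl⟩, ?_⟩
    simp [map_list_prod, Function.comp_def]

/-- A bijection of generators induces an isomorphism of free algebras. -/
noncomputable def freeAlgebraCongr (K : Type w) [Field K] {E : Type u} {F : Type v} (g : E ≃ F) :
    FreeAlgebra K E ≃ₐ[K] FreeAlgebra K F :=
  AlgEquiv.ofAlgHom (FreeAlgebra.lift K (FreeAlgebra.ι K ∘ g))
    (FreeAlgebra.lift K (FreeAlgebra.ι K ∘ g.symm)) (by ext; simp) (by ext; simp)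

namespace LayeredGraph

variable {Γ : LayeredGraph.{u, v}}

theorem exists_algEquiv_freeAlgebra (K : Type w) [Field K] {F : Type*} (g : Γ.E ≃ F)
    (hrel : ∀ x y, Γ.Rel K x y → x = y) :
    ∃ φ : Γ.Alg K ≃ₐ[K] FreeAlgebra K F,
      ∀ i, (Γ.degree K i).map φ.toLinearMap = freeDegree K F i := by
  let π : Γ.Alg K →ₐ[K] FreeAlgebra K Γ.E :=
    RingQuot.liftAlgHom K ⟨AlgHom.id K _, fun x y h => hrel x y h⟩
  have hπ : ∀ x, π (RingQuot.mkAlgHom K (Γ.Rel K) x) = x := fun x =>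
    RingQuot.liftAlgHom_mkAlgHom_apply K (AlgHom.id K (FreeAlgebra K Γ.E)) _ x
  let ψ : Γ.Alg K ≃ₐ[K] FreeAlgebra K Γ.E :=
    AlgEquiv.ofAlgHom π (RingQuot.mkAlgHom K (Γ.Rel K)) (by ext; simp [hπ]) (by ext; simp [hπ])
  refine ⟨ψ.trans (freeAlgebraCongr K g), fun i => ?_⟩
  rw [degree, ← Submodule.map_comp, ← map_equiv_freeDegree K g]
  congr 1
  ext x
  simp [ψ, hπ, freeAlgebraCongr]

/-- An edge is determined by the level of its head, which can be any of 0, …, n - 1. -/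
theorem IsComplete.nonempty_edge_equiv {n : ℕ} {m : ℕ → ℕ} (hΓ : Γ.IsComplete n m)
    (hone : ∀ i ≤ n, m i = 1) : Function.Injective Γ.level ∧ Nonempty (Γ.E ≃ Fin n) := by
  have hex : ∀ i ≤ n, ∃ c, {a | Γ.level a = i} = {c} := fun i hi =>
    Set.encard_eq_one.1 (by rw [hΓ.card_level i hi, hone i hi]; rfl)
  have hinj : Function.Injective Γ.level := by
    intro a b hab
    obtain ⟨c, hc⟩ := hex _ (hΓ.level_le a)
    have ha : a ∈ {x | Γ.level x = Γ.level a} := rfl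
    have hb : b ∈ {x | Γ.level x = Γ.level a} := hab.symm
    rw [hc] at ha hb
    exact ha.trans hb.symm
  refine ⟨hinj, ⟨Equiv.ofBijective (fun e => ⟨Γ.level (Γ.head e), ?_⟩) ⟨?_, ?_⟩⟩⟩
  · have := Γ.level_tail e
    have := hΓ.level_le (Γ.tail e)
    omega
  · intro e e' h
    have hh : Γ.level (Γ.head e) = Γ.level (Γ.head e') := congrArg Fin.val h
    have ht : Γ.level (Γ.tail e) = Γ.level (Γ.tail e') := by
      rw [Γ.level_tail, Γ.level_tail, hh]
    exact (hΓ.existsUnique_edge _ _ (Γ.level_tail e)).unique ⟨rfl, rfl⟩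
      ⟨(hinj ht).symm, (hinj hh).symm⟩
  · rintro ⟨i, hi⟩
    obtain ⟨b, hb⟩ := hex i hi.le
    obtain ⟨a, ha⟩ := hex (i + 1) hi
    have hb' : Γ.level b = i := hb.symm.subset rfl
    have ha' : Γ.level a = i + 1 := ha.symm.subset rfl
    obtain ⟨e, ⟨rfl, rfl⟩, -⟩ := hΓ.existsUnique_edge a b (by omega)
    exact ⟨e, Fin.ext hb'⟩

end LayeredGraph

theorem theorem5 (K : Type w) [Field K] (n : ℕ) (m : ℕ → ℕ) (hm : m 0 = 1)
    (Γ : LayeredGraph.{u, v}) (hΓ : Γ.IsComplete n m)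
    (hout : ∀ a, 0 < Γ.level a → ∃ e, Γ.tail e = a) :
    (1 - PowerSeries.X) * (hilbertSeries (Γ.degree K))⁻¹ =
        1 - ∑ k ∈ Finset.range (n + 1), ∑ a ∈ Finset.Icc k n,
          PowerSeries.C ((-1) ^ k * layerProd m k a) * PowerSeries.X ^ (k + 1) ∧
      ((∀ i ≤ n, m i = 1) →
        (∃ φ : Γ.Alg K ≃ₐ[K] FreeAlgebra K (Fin n),
          ∀ i, (Γ.degree K i).map φ.toLinearMap = freeDegree K (Fin n) i) ∧
        hilbertSeries (Γ.degree K) = (1 - (n : PowerSeries ℚ) * PowerSeries.X)⁻¹ ∧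
        hilbertSeries (freeDegree K (Fin n)) = (1 - (n : PowerSeries ℚ) * PowerSeries.X)⁻¹) := by
  have hmul := hΓ.hilbertSeries_mul K hm hout
  have hc : PowerSeries.constantCoeff (hilbertSeries (Γ.degree K)) ≠ 0 := fun h => by
    have := congrArg PowerSeries.constantCoeff hmul
    rw [map_mul, h, zero_mul, map_one] at this
    exact zero_ne_one this
  refine ⟨?_, fun hone => ?_⟩
  · rw [one_sub_sum_layerProd m hm]
    congr 1
    rw [PowerSeries.inv_eq_iff_mul_eq_one hc, mul_comm]
    exact hmul
  · obtain ⟨hinj, ⟨g⟩⟩ := hΓ.nonempty_edge_equiv hone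
    obtain ⟨φ, hφ⟩ := LayeredGraph.exists_algEquiv_freeAlgebra K g
      fun x y => LayeredGraph.eq_of_rel hΓ.existsUnique_edge hinj
    have hH : hilbertSeries (Γ.degree K) = (1 - (n : PowerSeries ℚ) * PowerSeries.X)⁻¹ := by
      -- Every factor m_i - 1 vanishes, so only the constant term survives.
      have hG : ∀ a ≤ n, chainSeries m a = 1 := by
        intro a ha
        cases a with
        | zero => rfl
        | succ a => simp [chainSeries, hone a (by omega)]
      have hsum : ∑ a ∈ Finset.Icc 1 n, PowerSeries.C (m a : ℚ) * chainSeries m a =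
          (n : PowerSeries ℚ) := by
        rw [Finset.sum_congr rfl fun a ha => by
          rw [hG a (Finset.mem_Icc.1 ha).2, hone a (Finset.mem_Icc.1 ha).2]]
        simp
      rw [hsum, mul_comm PowerSeries.X] at hmul
      rw [PowerSeries.eq_inv_iff_mul_eq_one (by simp)]
      exact hmul
    refine ⟨⟨φ, hφ⟩, hH, ?_⟩
    rw [← hH]
    ext i
    simp only [hilbertSeries, PowerSeries.coeff_mk]
    rw [← hφ i]
    exact congrArg _ (LinearEquiv.finrank_map_eq φ.toLinearEquiv _)
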